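/- Let $(f_n)_{n\ge 0}$ be a sequence of real polynomials of binomial type with $f_0=1$, i.e. $f_n(x+y)=\sum_{k=0}^n\binom nk f_k(x)f_{n-k}(y)$ for all $n\ge 0$ and $x,y\in\mathbb R$. For $a\in\mathbb R$ let $f_0(x;a)=1$ and, for $n\ge1$, $f_n(x;a)=\frac{x}{an+x}f_n(an+x)$, which is a polynomial in $x$ because $f_n(0)=0$. The partial Bell polynomials $B_{n,k}(x_1,x_2,\dots)$ are defined by $\sum_{n\ge k}B_{n,k}(x_1,x_2,\dots)\frac{t^n}{n!}=\frac1{k!}\Bigl(\sum_{m\ge1}x_m\frac{t^m}{m!}\Bigr)^k$, and the complete Bell polynomials by $A_0=1$ and $A_n(x_1,\dots,x_n)=\sum_{k=1}^nB_{n,k}(x_1,x_2,\dots)$ for $n\ge1$. Let $a,x,\alpha$ be real numbers and let $n,r,s$ be integers with $n\ge1$, $r\ge1$, $s\ge0$. For integers $m\ge1$, $q\ge0$ put $R(m,q)=mr+q$. (i) If $\alpha\ne0$, then $$Z(m,q):=\frac1{\alpha^{q}}\,\frac1R\,\frac{d^{R}}{dz^{R}}\Bigl[e^{\alpha z}f_m(Rx+z;a)\Bigr]_{z=0},\qquad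 R=R(m,q),$$ satisfies $$A_n\bigl(sZ(1,0),sZ(2,0),\dots,sZ(n,0)\bigr)=s\,Z(n,s).\tag{$*$}$$ (ii) (The case corresponding to $\alpha=0$.) If $f_1'(0)\neq0$ (which is automatic when every $f_n$ has degree $n$), then $$Z(m,q):=\frac1{(f_1'(0))^{q}}\,\frac1R\,\frac{m!}{(R+m)!}\,\frac{d^{R}}{dz^{R}}\Bigl[f_{R+m}(Rx+z;a)\Bigr]_{z=0},\qquad R=R(m,q),$$ also satisfies $(*)$. -/

import Mathlib

namespace BellBinomial

open Polynomial

/-- The partial Bell polynomial `B_{n,k}(x₁, x₂, …)`, through its generating function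
`∑ₙ B_{n,k} tⁿ/n! = (1/k!) (∑_{m ≥ 1} x_m t^m/m!)^k`. The value `x 0` is not used. -/
noncomputable def partialBell (x : ℕ → ℝ) (n k : ℕ) : ℝ :=
  (n.factorial : ℝ) *
    PowerSeries.coeff n
      (PowerSeries.C (1 / (k.factorial : ℝ)) *
        (PowerSeries.mk fun m => if m = 0 then 0 else x m / (m.factorial : ℝ)) ^ k)

/-- The complete Bell polynomial `A_n(x₁, …, x_n) = ∑_{k=1}^n B_{n,k}(x₁, x₂, …)`, `A_0 = 1`. -/
noncomputable def completeBell (x : ℕ → ℝ) (n : ℕ) : ℝ :=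
  if n = 0 then 1 else ∑ k ∈ Finset.Icc 1 n, partialBell x n k

/-- A sequence of real polynomials of binomial type, normalised by `f₀ = 1`. -/
structure IsBinomialType (f : ℕ → ℝ[X]) : Prop where
  zero : f 0 = 1
  add : ∀ (n : ℕ) (x y : ℝ),
    (f n).eval (x + y) =
      ∑ k ∈ Finset.range (n + 1), (n.choose k : ℝ) * (f k).eval x * (f (n - k)).eval y

/-- The polynomials `f_n(x; a) = x / (a n + x) · f_n(a n + x)`, with `f_0(x; a) = 1`.
Since `f_n(0) = 0` for `n ≥ 1`, the quotient `f_n(X) / X` is the polynomial `divX`, so that the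
value at the removable singularity `x = -a n` is the continuous one. -/
noncomputable def shifted (f : ℕ → ℝ[X]) (a : ℝ) (n : ℕ) : ℝ[X] :=
  if n = 0 then 1 else X * (f n).divX.comp (C (a * (n : ℝ)) + X)

theorem IsBinomialType.eval_zero {f : ℕ → ℝ[X]} (hf : IsBinomialType f) {n : ℕ} (hn : n ≠ 0) :
    (f n).eval 0 = 0 := by
  induction n using Nat.strong_induction_on with
  | _ n ih =>
    obtain ⟨m, rfl⟩ := Nat.exists_eq_succ_of_ne_zero hn
    have h := hf.add (m + 1) 0 0
    rw [Finset.sum_range_succ, Finset.sum_range_succ', Finset.sum_eq_zero] at h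
    · simp [hf.zero] at h
      simpa using h
    · intro k hk
      rw [ih (k + 1) (by simp at hk; omega) (by omega)]
      simp

/-- The defining formula of `f_n(x; a)` away from the removable singularity. -/
theorem IsBinomialType.eval_shifted {f : ℕ → ℝ[X]} (hf : IsBinomialType f) (a x : ℝ) (n : ℕ)
    (h : a * n + x ≠ 0) :
    (shifted f a n).eval x = x / (a * n + x) * (f n).eval (a * n + x) := by
  unfold shifted
  split_ifs with hn
  · subst hn
    have hx : x ≠ 0 := by simpa using h
    simp [hf.zero, hx]
  · have key := congrArg (eval (a * n + x)) (divX_mul_X_add (f n))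
    rw [coeff_zero_eq_eval_zero, hf.eval_zero hn] at key
    simp only [map_zero, add_zero, eval_mul, eval_X] at key
    simp only [eval_mul, eval_X, eval_comp, eval_add, eval_C]
    rw [← key]
    field_simp

/-- For `R = n r + s`,
`Z(n, s) = α^{-s} · (1/R) · (d/dz)^R [e^{α z} f_n(R x + z; a)]` at `z = 0`. -/
noncomputable def zExp (f : ℕ → ℝ[X]) (a x α : ℝ) (r n s : ℕ) : ℝ :=
  1 / α ^ s * (1 / ((n * r + s : ℕ) : ℝ)) *
    iteratedDeriv (n * r + s)
      (fun z : ℝ => Real.exp (α * z) * (shifted f a n).eval (((n * r + s : ℕ) : ℝ) * x + z)) 0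

/-- For `R = n r + s`,
`Z(n, s) = f₁'(0)^{-s} · (1/R) · n!/(R + n)! · (d/dz)^R f_{R+n}(R x + z; a)` at `z = 0`. -/
noncomputable def zPoly (f : ℕ → ℝ[X]) (a x : ℝ) (r n s : ℕ) : ℝ :=
  1 / (deriv (fun z : ℝ => (f 1).eval z) 0) ^ s * (1 / ((n * r + s : ℕ) : ℝ)) *
    ((n.factorial : ℝ) / ((n * r + s + n).factorial : ℝ)) *
    iteratedDeriv (n * r + s)
      (fun z : ℝ => (shifted f a (n * r + s + n)).eval (((n * r + s : ℕ) : ℝ) * x + z)) 0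

end BellBinomial

namespace BellBinomial

open Polynomial

/-! A binomial-type sequence `p` has generating function `exp (x g(t))` with `g = logEgf p`, so `p
n` at `y` is the complete Bell polynomial in the numbers `y (p m).coeff 1` (`completeBell_eq_eval`).
The operation `shifted` preserves binomial type: by Lagrange inversion it substitutes a series for
`t` (`lagrange_mul`, `egf_shifted`).

Differentiating in `z` multiplies the generating function by `g`, and the factor `e^{α z}` turns `g`
into `α + g`. Hence in both cases `Z(m, q) = β^{-q} (m!/R) [t^m] Φ^R` with `Φ(0) = β ≠ 0`. After
normalising `Φ` to constant term 1, its powers are interpolated by a binomial-type sequence `F`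
(`powPoly`). Then `s Z(n, s)` is the value of `shifted F r n` at `s`, and `Z(m, 0)` is the linear
coefficient of `shifted F r m`, so `(*)` is the Bell formula for `shifted F r`
(`completeBell_of_coeff_pow`). -/

/-! ### Generating functions of binomial-type sequences -/

/-- The exponential generating function `∑ₙ f_n(y) tⁿ/n!`. -/
noncomputable def egf (f : ℕ → ℝ[X]) (y : ℝ) : PowerSeries ℝ :=
  PowerSeries.mk fun n => (f n).eval y / (n.factorial : ℝ)

/-- The series `∑ₙ f_n'(0) tⁿ/n!`. -/
noncomputable def logEgf (f : ℕ → ℝ[X]) : PowerSeries ℝ :=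
  PowerSeries.mk fun n => (f n).coeff 1 / (n.factorial : ℝ)

theorem eval_eq_factorial_mul_coeff_egf (f : ℕ → ℝ[X]) (n : ℕ) (y : ℝ) :
    (f n).eval y = n.factorial * PowerSeries.coeff n (egf f y) := by
  have : (n.factorial : ℝ) ≠ 0 := by positivity
  simp only [egf, PowerSeries.coeff_mk]
  field_simp

theorem choose_mul_mul_div_factorial {n k : ℕ} (h : k ≤ n) (u v : ℝ) :
    (n.choose k : ℝ) * u * v / n.factorial =
      u / k.factorial * (v / (n - k).factorial) := by
  have h1 : (n.factorial : ℝ) ≠ 0 := by positivity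
  have h2 : (k.factorial : ℝ) ≠ 0 := by positivity
  have h3 : ((n - k).factorial : ℝ) ≠ 0 := by positivity
  rw [Nat.cast_choose ℝ h]
  field_simp

/-- Being of binomial type means that the generating functions are multiplicative. -/
theorem coeff_egf_mul (f : ℕ → ℝ[X]) (x y : ℝ) (n : ℕ) :
    PowerSeries.coeff n (egf f x * egf f y) =
      (∑ k ∈ Finset.range (n + 1), (n.choose k : ℝ) * (f k).eval x * (f (n - k)).eval y) /
        n.factorial := by
  rw [PowerSeries.coeff_mul, Finset.Nat.sum_antidiagonal_eq_sum_range_succ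
    (fun i j => PowerSeries.coeff i (egf f x) * PowerSeries.coeff j (egf f y)),
    Finset.sum_div]
  refine Finset.sum_congr rfl fun k hk => ?_
  rw [choose_mul_mul_div_factorial (Nat.lt_succ_iff.mp (Finset.mem_range.mp hk))]
  simp [egf]

theorem isBinomialType_of_egf_add {f : ℕ → ℝ[X]} (h0 : f 0 = 1)
    (h : ∀ x y, egf f (x + y) = egf f x * egf f y) : IsBinomialType f := by
  refine ⟨h0, fun n x y => ?_⟩
  have : (n.factorial : ℝ) ≠ 0 := by positivity
  rw [eval_eq_factorial_mul_coeff_egf, h, coeff_egf_mul]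
  field_simp

namespace IsBinomialType

variable {f : ℕ → ℝ[X]}

theorem egf_add (hf : IsBinomialType f) (x y : ℝ) : egf f (x + y) = egf f x * egf f y := by
  ext n
  rw [coeff_egf_mul, ← hf.add]
  simp [egf]

theorem egf_zero (hf : IsBinomialType f) : egf f 0 = 1 := by
  ext n
  rcases eq_or_ne n 0 with rfl | hn
  · simp [egf, hf.zero]
  · simp [egf, hf.eval_zero hn, PowerSeries.coeff_one, hn]

theorem egf_natCast_mul (hf : IsBinomialType f) (k : ℕ) (x : ℝ) : egf f (k * x) = egf f x ^ k := by
  induction k with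
  | zero => simp [hf.egf_zero]
  | succ k ih => rw [Nat.cast_succ, add_one_mul, hf.egf_add, ih, pow_succ]

theorem coeff_zero_egf (hf : IsBinomialType f) (y : ℝ) : PowerSeries.coeff 0 (egf f y) = 1 := by
  simp [egf, hf.zero]

theorem constantCoeff_logEgf (hf : IsBinomialType f) : PowerSeries.constantCoeff (logEgf f) = 0 := by
  rw [← PowerSeries.coeff_zero_eq_constantCoeff_apply]
  simp [logEgf, hf.zero, Polynomial.coeff_one]

theorem X_dvd_logEgf (hf : IsBinomialType f) : PowerSeries.X ∣ logEgf f :=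
  PowerSeries.X_dvd_iff.mpr hf.constantCoeff_logEgf

/-- At 0 this is the definition of `logEgf`; multiplicativity of `egf` carries it to `z`. The free
factor `H` allows iteration. -/
theorem hasDerivAt_coeff_mul_egf (hf : IsBinomialType f) (H : PowerSeries ℝ) (n : ℕ) (z : ℝ) :
    HasDerivAt (fun w => PowerSeries.coeff n (H * egf f w))
      (PowerSeries.coeff n (H * logEgf f * egf f z)) z := by
  have base : ∀ H : PowerSeries ℝ, HasDerivAt (fun w => PowerSeries.coeff n (H * egf f w))
      (PowerSeries.coeff n (H * logEgf f)) 0 := by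
    intro H
    simp only [PowerSeries.coeff_mul]
    refine HasDerivAt.fun_sum fun p _ => HasDerivAt.const_mul _ ?_
    simp only [egf, logEgf, PowerSeries.coeff_mk]
    refine HasDerivAt.div_const ?_ _
    have hd := (f p.2).hasDerivAt 0
    rwa [← coeff_zero_eq_eval_zero, coeff_derivative, Nat.cast_zero, zero_add, zero_add,
      mul_one] at hd
  have h := base (H * egf f z)
  rw [← sub_self z] at h
  have h2 := h.comp_sub_const z z
  rw [mul_right_comm]
  refine h2.congr_of_eventuallyEq (Filter.Eventually.of_forall fun w => ?_)
  simp only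
  rw [mul_assoc, ← hf.egf_add, add_sub_cancel]

theorem eval_iterate_derivative (hf : IsBinomialType f) (n k : ℕ) (z : ℝ) :
    (derivative^[k] (f n)).eval z =
      n.factorial * PowerSeries.coeff n (logEgf f ^ k * egf f z) := by
  induction k generalizing z with
  | zero => simp [eval_eq_factorial_mul_coeff_egf]
  | succ k ih =>
    rw [Function.iterate_succ_apply', pow_succ]
    refine (derivative^[k] (f n)).hasDerivAt z |>.unique ?_
    rw [funext ih]
    exact (hf.hasDerivAt_coeff_mul_egf _ n z).const_mul _

theorem coeff_eq (hf : IsBinomialType f) (n k : ℕ) :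
    (f n).coeff k = n.factorial / k.factorial * PowerSeries.coeff n (logEgf f ^ k) := by
  have h := hf.eval_iterate_derivative n k 0
  rw [hf.egf_zero, mul_one, ← coeff_zero_eq_eval_zero, coeff_iterate_derivative, zero_add,
    Nat.descFactorial_self, nsmul_eq_mul] at h
  have : (k.factorial : ℝ) ≠ 0 := by positivity
  field_simp
  linarith

theorem coeff_logEgf_pow_eq_zero (hf : IsBinomialType f) {n k : ℕ} (h : n < k) :
    PowerSeries.coeff n (logEgf f ^ k) = 0 :=
  PowerSeries.X_pow_dvd_iff.mp (pow_dvd_pow_of_dvd hf.X_dvd_logEgf k) n h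

theorem natDegree_le (hf : IsBinomialType f) (n : ℕ) : (f n).natDegree ≤ n := by
  refine natDegree_le_iff_coeff_eq_zero.mpr fun k hk => ?_
  rw [hf.coeff_eq, hf.coeff_logEgf_pow_eq_zero hk, mul_zero]

/-- `egf f y = exp (y * logEgf f)`, coefficientwise. -/
theorem coeff_egf (hf : IsBinomialType f) {n N : ℕ} (h : n < N) (y : ℝ) :
    PowerSeries.coeff n (egf f y) =
      ∑ k ∈ Finset.range N, y ^ k / k.factorial * PowerSeries.coeff n (logEgf f ^ k) := by
  have hn : (n.factorial : ℝ) ≠ 0 := by positivity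
  rw [egf, PowerSeries.coeff_mk, eval_eq_sum_range' ((hf.natDegree_le n).trans_lt h),
    Finset.sum_div]
  refine Finset.sum_congr rfl fun k _ => ?_
  rw [hf.coeff_eq]
  field_simp

theorem completeBell_eq_eval (hf : IsBinomialType f) (y : ℝ) {n : ℕ} (hn : n ≠ 0) :
    completeBell (fun m => y * (f m).coeff 1) n = (f n).eval y := by
  have hmk : (PowerSeries.mk fun m =>
      if m = 0 then 0 else y * (f m).coeff 1 / (m.factorial : ℝ)) =
      PowerSeries.C y * logEgf f := by
    ext m
    rcases eq_or_ne m 0 with rfl | hm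
    · simp [hf.constantCoeff_logEgf]
    · simp [logEgf, hm, mul_div_assoc]
  have hIcc : Finset.Icc 1 n = Finset.Ico (0 + 1) (n + 1) := by ext; simp
  rw [eval_eq_factorial_mul_coeff_egf, hf.coeff_egf (Nat.lt_succ_self n), completeBell, if_neg hn,
    Finset.sum_range_succ', hIcc, ← Finset.sum_Ico_add' _ 0 n 1, Finset.range_eq_Ico,
    pow_zero, pow_zero, PowerSeries.coeff_one, if_neg hn, mul_zero, add_zero, Finset.mul_sum]
  refine Finset.sum_congr rfl fun k _ => ?_
  rw [partialBell, hmk, mul_pow, ← map_pow, PowerSeries.coeff_C_mul, PowerSeries.coeff_C_mul]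
  ring

theorem derivative_egf (hf : IsBinomialType f) (y : ℝ) :
    PowerSeries.derivative ℝ (egf f y) =
      PowerSeries.C y * PowerSeries.derivative ℝ (logEgf f) * egf f y := by
  ext n
  have hL : PowerSeries.coeff n (PowerSeries.derivative ℝ (egf f y)) =
      ∑ k ∈ Finset.range (n + 2), y ^ k / k.factorial *
        PowerSeries.coeff n (PowerSeries.derivative ℝ (logEgf f ^ k)) := by
    simp only [PowerSeries.coeff_derivative]
    rw [hf.coeff_egf (Nat.lt_succ_self (n + 1)), Finset.sum_mul]
    exact Finset.sum_congr rfl fun k _ => by ring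
  have hR : PowerSeries.coeff n (PowerSeries.derivative ℝ (logEgf f) * egf f y) =
      ∑ k ∈ Finset.range (n + 1), y ^ k / k.factorial *
        PowerSeries.coeff n (PowerSeries.derivative ℝ (logEgf f) * logEgf f ^ k) := by
    simp only [PowerSeries.coeff_mul, Finset.mul_sum]
    rw [Finset.sum_comm]
    refine Finset.sum_congr rfl fun p hp => ?_
    rw [hf.coeff_egf (Nat.lt_succ_of_le (Finset.HasAntidiagonal.antidiagonal.snd_le hp)), 
      Finset.mul_sum]
    exact Finset.sum_congr rfl fun k _ => by ring
  rw [hL, mul_assoc, PowerSeries.coeff_C_mul, hR, Finset.sum_range_succ', Finset.mul_sum]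
  simp only [pow_zero, Derivation.map_one_eq_zero, mul_zero, add_zero, map_zero]
  refine Finset.sum_congr rfl fun k _ => ?_
  have hd : PowerSeries.derivative ℝ (logEgf f ^ (k + 1)) =
      PowerSeries.C ((k + 1 : ℕ) : ℝ) * (PowerSeries.derivative ℝ (logEgf f) * logEgf f ^ k) := by
    rw [Derivation.leibniz_pow]
    simp [mul_comm]
  have : ((k + 1 : ℕ) : ℝ) ≠ 0 := by positivity
  have : (k.factorial : ℝ) ≠ 0 := by positivity
  rw [hd, PowerSeries.coeff_C_mul, Nat.factorial_succ, Nat.cast_mul]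
  field_simp
  ring

end IsBinomialType

/-! ### Lagrange inversion and the shifted sequence -/

theorem coeff_X_mul_derivative (F : PowerSeries ℝ) (n : ℕ) :
    PowerSeries.coeff n (PowerSeries.X * PowerSeries.derivative ℝ F) =
      n * PowerSeries.coeff n F := by
  cases n with
  | zero => simp
  | succ n =>
    rw [PowerSeries.coeff_succ_X_mul, PowerSeries.coeff_derivative]
    push_cast
    ring

/-- With `g = logEgf f`, the series whose `n`-th coefficient is that of
`(1 - a t g'(t)) exp (a n g(t)) H(t)`. By Lagrange inversion this is `H ∘ W`, where `W` solves
`W = t exp (a g(W))`. -/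
noncomputable def lagrange (f : ℕ → ℝ[X]) (a : ℝ) (H : PowerSeries ℝ) : PowerSeries ℝ :=
  PowerSeries.mk fun n => PowerSeries.coeff n
    ((1 - PowerSeries.C a * (PowerSeries.X * PowerSeries.derivative ℝ (logEgf f))) *
      egf f (a * n) * H)

theorem lagrange_add (f : ℕ → ℝ[X]) (a : ℝ) (H K : PowerSeries ℝ) :
    lagrange f a (H + K) = lagrange f a H + lagrange f a K := by
  ext n
  simp [lagrange, mul_add]

theorem lagrange_C_mul (f : ℕ → ℝ[X]) (a c : ℝ) (H : PowerSeries ℝ) :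
    lagrange f a (PowerSeries.C c * H) = PowerSeries.C c * lagrange f a H := by
  ext n
  simp only [lagrange, PowerSeries.coeff_mk, PowerSeries.coeff_C_mul, mul_left_comm _
    (PowerSeries.C c)]

namespace IsBinomialType

variable {f : ℕ → ℝ[X]}

theorem coeff_X_mul_derivative_logEgf_mul_egf (hf : IsBinomialType f) (y : ℝ) (n : ℕ) :
    y * PowerSeries.coeff n
      (PowerSeries.X * PowerSeries.derivative ℝ (logEgf f) * egf f y) =
      n * PowerSeries.coeff n (egf f y) := by
  rw [← coeff_X_mul_derivative, hf.derivative_egf, ← PowerSeries.coeff_C_mul]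
  congr 1
  ring

theorem lagrange_one (hf : IsBinomialType f) (a : ℝ) : lagrange f a 1 = 1 := by
  ext n
  have h := hf.coeff_X_mul_derivative_logEgf_mul_egf (a * n) n
  rw [lagrange, PowerSeries.coeff_mk, mul_one, sub_mul, one_mul, mul_assoc (PowerSeries.C a),
    map_sub, PowerSeries.coeff_C_mul, PowerSeries.coeff_one]
  rcases eq_or_ne n 0 with rfl | hn
  · simp [hf.egf_zero]
  · have hn' : (n : ℝ) ≠ 0 := by exact_mod_cast hn
    rw [if_neg hn]
    apply mul_left_cancel₀ hn'
    linarith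

/-- The series `t exp (-a g(t))` is the compositional inverse of `W`. Concretely, `X` lowers the
coefficient index by one and `egf f (-a)` corrects `a (n + 1)` to `a n`. -/
theorem lagrange_X_mul_egf_mul (hf : IsBinomialType f) (a : ℝ) (H : PowerSeries ℝ) :
    lagrange f a (PowerSeries.X * egf f (-a) * H) = PowerSeries.X * lagrange f a H := by
  ext n
  cases n with
  | zero => simp [lagrange, mul_left_comm _ PowerSeries.X, mul_assoc]
  | succ n =>
    rw [PowerSeries.coeff_succ_X_mul, lagrange, lagrange, PowerSeries.coeff_mk,
      PowerSeries.coeff_mk, ← PowerSeries.coeff_succ_X_mul n]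
    have h : egf f (a * (n + 1 : ℕ)) * egf f (-a) = egf f (a * n) := by
      rw [← hf.egf_add]
      congr 1
      push_cast
      ring
    rw [← h]
    exact congrArg (PowerSeries.coeff (n + 1)) (by ring)

theorem exists_eq_C_add (hf : IsBinomialType f) (a : ℝ) (H : PowerSeries ℝ) :
    ∃ c K, H = PowerSeries.C c + PowerSeries.X * egf f (-a) * K := by
  obtain ⟨K, hK⟩ : PowerSeries.X ∣ H - PowerSeries.C (PowerSeries.constantCoeff H) :=
    PowerSeries.X_dvd_iff.mpr (by simp)
  have h : egf f (-a) * egf f a = 1 := by rw [← hf.egf_add, neg_add_cancel, hf.egf_zero]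
  refine ⟨PowerSeries.constantCoeff H, egf f a * K, ?_⟩
  rw [mul_assoc, ← mul_assoc (egf f (-a)), h, one_mul, ← hK]
  ring

/-- Peeling off `H = c + t e^{-a g} L` pulls a factor `X` out of both sides, which reduces the claim
for `H` to a lower coefficient for `L`; no composition of series is needed. -/
theorem lagrange_mul (hf : IsBinomialType f) (a : ℝ) (H K : PowerSeries ℝ) :
    lagrange f a (H * K) = lagrange f a H * lagrange f a K := by
  suffices h : ∀ n, ∀ m ≤ n, ∀ H, PowerSeries.coeff m (lagrange f a (H * K)) =
      PowerSeries.coeff m (lagrange f a H * lagrange f a K) by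
    ext n
    exact h n n le_rfl H
  intro n
  induction n with
  | zero =>
    intro m hm H
    obtain rfl : m = 0 := by omega
    obtain ⟨c, L, rfl⟩ := hf.exists_eq_C_add a H
    have hc : lagrange f a (PowerSeries.C c) = PowerSeries.C c := by
      rw [← mul_one (PowerSeries.C c), lagrange_C_mul, hf.lagrange_one]
    rw [add_mul, mul_assoc (PowerSeries.X * _), lagrange_add, lagrange_add, lagrange_C_mul, hc,
      hf.lagrange_X_mul_egf_mul, hf.lagrange_X_mul_egf_mul, add_mul, mul_assoc PowerSeries.X]
    simp
  | succ n ih =>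
    intro m hm H
    obtain ⟨c, L, rfl⟩ := hf.exists_eq_C_add a H
    have hc : lagrange f a (PowerSeries.C c) = PowerSeries.C c := by
      rw [← mul_one (PowerSeries.C c), lagrange_C_mul, hf.lagrange_one]
    rw [add_mul, mul_assoc (PowerSeries.X * _), lagrange_add, lagrange_add, lagrange_C_mul, hc,
      hf.lagrange_X_mul_egf_mul, hf.lagrange_X_mul_egf_mul, add_mul, mul_assoc PowerSeries.X,
      map_add, map_add]
    congr 1
    cases m with
    | zero => simp
    | succ m =>
      rw [PowerSeries.coeff_succ_X_mul, PowerSeries.coeff_succ_X_mul, ih m (by omega)]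

theorem egf_shifted (hf : IsBinomialType f) (a x : ℝ) :
    egf (shifted f a) x = lagrange f a (egf f x) := by
  ext n
  rw [lagrange, PowerSeries.coeff_mk, mul_assoc, ← hf.egf_add, sub_mul, one_mul,
    mul_assoc (PowerSeries.C a), map_sub, PowerSeries.coeff_C_mul]
  rcases eq_or_ne n 0 with rfl | hn
  · simp [egf, shifted, hf.zero, mul_assoc]
  have hn' : (n.factorial : ℝ) ≠ 0 := by positivity
  -- At the removable singularity the value is `x (f n).coeff 1`; elsewhere the factor `1 - a n / (a
  -- n + x)` gives `x / (a n + x)`.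
  by_cases hy : a * n + x = 0
  · have hd : (f n).divX.eval 0 = (f n).coeff 1 := by
      rw [← coeff_zero_eq_eval_zero, coeff_divX]
    rw [hy, hf.egf_zero, mul_one, coeff_X_mul_derivative, PowerSeries.coeff_one, if_neg hn]
    simp only [egf, logEgf, shifted, if_neg hn, PowerSeries.coeff_mk, eval_mul, eval_X, eval_comp,
      eval_add, eval_C, hy, hd]
    field_simp
    linear_combination (f n).coeff 1 * hy
  · have h := hf.coeff_X_mul_derivative_logEgf_mul_egf (a * n + x) n
    have hE : PowerSeries.coeff n (egf (shifted f a) x) =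
        x / (a * n + x) * PowerSeries.coeff n (egf f (a * n + x)) := by
      simp only [egf, PowerSeries.coeff_mk, hf.eval_shifted a x n hy]
      ring
    rw [hE]
    field_simp
    linear_combination a * h

theorem shifted (hf : IsBinomialType f) (a : ℝ) : IsBinomialType (shifted f a) := by
  refine isBinomialType_of_egf_add (by simp [BellBinomial.shifted]) fun x y => ?_
  simp only [hf.egf_shifted]
  rw [hf.egf_add, hf.lagrange_mul]

end IsBinomialType

/-! ### Interpolating the powers of a series -/

/-- Polynomials `p_n` with `p_n(k) = n! [tⁿ] Ψ(t)^k`, for a power series `Ψ` with `Ψ(0) = 1`. -/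
noncomputable def powPoly (Ψ : PowerSeries ℝ) (n : ℕ) : ℝ[X] :=
  ∑ j ∈ Finset.range (n + 1),
    C ((n.factorial : ℝ) / j.factorial * PowerSeries.coeff n ((Ψ - 1) ^ j)) * descPochhammer ℝ j

theorem egf_powPoly {Ψ : PowerSeries ℝ} (hΨ : PowerSeries.constantCoeff Ψ = 1) (k : ℕ) :
    egf (powPoly Ψ) k = Ψ ^ k := by
  ext n
  have hn : (n.factorial : ℝ) ≠ 0 := by positivity
  have hX : PowerSeries.X ∣ Ψ - 1 := PowerSeries.X_dvd_iff.mpr (by simp [hΨ])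
  set c : ℕ → ℝ := fun j => PowerSeries.coeff n ((Ψ - 1) ^ j) * (k.choose j : ℝ) with hc
  have hzero : ∀ j, n < j ∨ k < j → c j = 0 := by
    rintro j (h | h)
    · rw [hc]
      simp only
      rw [PowerSeries.X_pow_dvd_iff.mp (pow_dvd_pow_of_dvd hX j) n h, zero_mul]
    · simp [hc, Nat.choose_eq_zero_of_lt h]
  have hsum : ∀ M, min n k ≤ M →
      ∑ j ∈ Finset.range (M + 1), c j = ∑ j ∈ Finset.range (min n k + 1), c j := by
    intro M hM
    refine (Finset.sum_subset (Finset.range_mono (by omega)) fun j _ hj => hzero j ?_).symm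
    simp only [Finset.mem_range] at hj
    omega
  have hl : PowerSeries.coeff n (egf (powPoly Ψ) k) = ∑ j ∈ Finset.range (n + 1), c j := by
    rw [egf, PowerSeries.coeff_mk, powPoly, eval_finsetSum, Finset.sum_div]
    refine Finset.sum_congr rfl fun j _ => ?_
    have hj : (j.factorial : ℝ) ≠ 0 := by positivity
    rw [eval_mul, eval_C, descPochhammer_eval_eq_descFactorial,
      Nat.descFactorial_eq_factorial_mul_choose]
    push_cast
    field_simp
    rfl
  have hr : PowerSeries.coeff n (Ψ ^ k) = ∑ j ∈ Finset.range (k + 1), c j := by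
    rw [show Ψ = (Ψ - 1) + 1 by ring, add_pow, map_sum]
    refine Finset.sum_congr rfl fun j _ => ?_
    rw [one_pow, mul_one, ← map_natCast (PowerSeries.C (R := ℝ)), PowerSeries.coeff_mul_C]
  rw [hl, hr, hsum n (min_le_left _ _), hsum k (min_le_right _ _)]

theorem eq_of_eval_natCast_eq {p q : ℝ[X]} (h : ∀ k : ℕ, p.eval (k : ℝ) = q.eval (k : ℝ)) :
    p = q :=
  eq_of_infinite_eval_eq p q <| (Set.infinite_range_of_injective Nat.cast_injective).mono <| by
    rintro _ ⟨k, rfl⟩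
    exact h k

/-- On natural arguments this is `Ψ^i Ψ^j = Ψ^(i+j)`; it extends to real arguments one variable at a
time, as an identity of polynomials. -/
theorem isBinomialType_powPoly {Ψ : PowerSeries ℝ} (hΨ : PowerSeries.constantCoeff Ψ = 1) :
    IsBinomialType (powPoly Ψ) := by
  set f := powPoly Ψ
  have hnat : ∀ (n i j : ℕ), (f n).eval ((i : ℝ) + j) =
      ∑ k ∈ Finset.range (n + 1), (n.choose k : ℝ) * (f k).eval (i : ℝ) *
        (f (n - k)).eval (j : ℝ) := by
    intro n i j
    have hn : (n.factorial : ℝ) ≠ 0 := by positivity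
    have h := coeff_egf_mul f i j n
    rw [egf_powPoly hΨ, egf_powPoly hΨ, ← pow_add, ← egf_powPoly hΨ] at h
    rw [← Nat.cast_add, eval_eq_factorial_mul_coeff_egf, h]
    field_simp
  have hx : ∀ (n j : ℕ) (x : ℝ), (f n).eval (x + j) =
      ∑ k ∈ Finset.range (n + 1), (n.choose k : ℝ) * (f k).eval x * (f (n - k)).eval (j : ℝ) := by
    intro n j x
    have h : (f n).comp (X + C (j : ℝ)) = ∑ k ∈ Finset.range (n + 1),
        C (n.choose k : ℝ) * f k * C ((f (n - k)).eval (j : ℝ)) :=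
      eq_of_eval_natCast_eq fun i => by
        simpa only [eval_comp, eval_add, eval_X, eval_C, eval_finsetSum, eval_mul] using hnat n i j
    simpa only [eval_comp, eval_add, eval_X, eval_C, eval_finsetSum, eval_mul] using
      congrArg (eval x) h
  refine ⟨by simp [f, powPoly], fun n x y => ?_⟩
  have h : (f n).comp (C x + X) = ∑ k ∈ Finset.range (n + 1),
      C (n.choose k : ℝ) * C ((f k).eval x) * f (n - k) :=
    eq_of_eval_natCast_eq fun j => by
      simpa only [eval_comp, eval_add, eval_X, eval_C, eval_finsetSum, eval_mul] using hx n j x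
  simpa only [eval_comp, eval_add, eval_X, eval_C, eval_finsetSum, eval_mul] using
    congrArg (eval y) h

/-- If `z m q = β^{-q} (m!/R) [t^m] Φ(t)^R` with `R = m r + q` and `Φ(0) = β ≠ 0`, then the complete
Bell polynomials send `s z(·, 0)` to `s z(·, s)`. -/
theorem completeBell_of_coeff_pow {Φ : PowerSeries ℝ} {β : ℝ}
    (hΦ : PowerSeries.constantCoeff Φ = β) (hβ : β ≠ 0) {r n : ℕ} (s : ℕ) (hr : r ≠ 0)
    (hn : n ≠ 0) (z : ℕ → ℕ → ℝ)
    (hz : ∀ m q, z m q = 1 / β ^ q * (1 / ((m * r + q : ℕ) : ℝ)) *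
      (m.factorial * PowerSeries.coeff m (Φ ^ (m * r + q)))) :
    completeBell (fun m => (s : ℝ) * z m 0) n = s * z n s := by
  -- Replacing `t` by `β^r t` leaves exactly `β^{-q}` in the coefficient of `t^m` in `Ψ^(m r + q)`.
  set Ψ := PowerSeries.rescale (β ^ r) (PowerSeries.C β⁻¹ * Φ) with hΨdef
  have hΨ : PowerSeries.constantCoeff Ψ = 1 := by
    rw [← PowerSeries.coeff_zero_eq_constantCoeff_apply, hΨdef, PowerSeries.coeff_rescale]
    simp [hΦ, hβ]
  set f := powPoly Ψ
  have hf : IsBinomialType f := isBinomialType_powPoly hΨ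
  have hR : ∀ m q, (f m).eval ((m * r + q : ℕ) : ℝ) =
      1 / β ^ q * (m.factorial * PowerSeries.coeff m (Φ ^ (m * r + q))) := by
    intro m q
    rw [eval_eq_factorial_mul_coeff_egf, egf_powPoly hΨ, hΨdef, ← map_pow,
      PowerSeries.coeff_rescale, mul_pow, ← map_pow, PowerSeries.coeff_C_mul]
    have hβ' : (β ^ r) ^ m * β⁻¹ ^ (m * r + q) = 1 / β ^ q := by
      rw [← pow_mul, mul_comm r m, pow_add, ← mul_assoc, ← mul_pow, mul_inv_cancel₀ hβ, one_pow,
        one_mul, inv_pow, one_div]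
    rw [← hβ']
    ring
  have h0 : (fun m => (s : ℝ) * z m 0) = fun m => (s : ℝ) * (shifted f r m).coeff 1 := by
    funext m
    congr 1
    rcases eq_or_ne m 0 with rfl | hm
    -- Here `R = 0`, and `1 / 0 = 0` matches the linear coefficient of the constant 1.
    · simp [hz, shifted, Polynomial.coeff_one]
    · have hd := congrArg (eval ((m * r : ℕ) : ℝ)) (divX_mul_X_add (f m))
      rw [coeff_zero_eq_eval_zero, hf.eval_zero hm] at hd
      simp only [map_zero, add_zero, eval_mul, eval_X] at hd
      have hmr : ((m * r : ℕ) : ℝ) ≠ 0 := by exact_mod_cast mul_ne_zero hm hr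
      have h := hR m 0
      rw [pow_zero, div_one, one_mul, add_zero, ← hd] at h
      rw [shifted, if_neg hm, Polynomial.coeff_X_mul, coeff_zero_eq_eval_zero, hz, add_zero,
        ← h, eval_comp]
      simp only [eval_add, eval_C, eval_X, add_zero]
      rw [mul_comm (r : ℝ), ← Nat.cast_mul]
      field_simp
  rw [h0, (hf.shifted r).completeBell_eq_eval _ hn, hz]
  have hpos : ((n * r + s : ℕ) : ℝ) ≠ 0 := by
    have := Nat.pos_of_ne_zero (mul_ne_zero hn hr)
    exact_mod_cast (by omega : n * r + s ≠ 0)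
  have hcast : (r : ℝ) * n + s = ((n * r + s : ℕ) : ℝ) := by push_cast; ring
  rw [hf.eval_shifted r s n (by rwa [hcast]), hcast, hR]
  ring

/-! ### Derivatives as coefficients of powers, and the conclusion -/

/-- Higher derivatives of `e^{α z} p_m(y + z)`, through generating functions. -/
theorem IsBinomialType.iteratedDeriv_exp_mul_eval {p : ℕ → ℝ[X]} (hp : IsBinomialType p)
    (α y : ℝ) (m R : ℕ) :
    iteratedDeriv R (fun z : ℝ => Real.exp (α * z) * (p m).eval (y + z)) = fun z =>
      Real.exp (α * z) * (m.factorial * PowerSeries.coeff m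
        ((PowerSeries.C α + logEgf p) ^ R * egf p (y + z))) := by
  induction R with
  | zero => simp [eval_eq_factorial_mul_coeff_egf]
  | succ R ih =>
    rw [iteratedDeriv_succ, ih]
    funext z
    set H := (PowerSeries.C α + logEgf p) ^ R with hH
    have h1 := ((hp.hasDerivAt_coeff_mul_egf H m (y + z)).comp_const_add y z).const_mul
      (m.factorial : ℝ)
    have h2 : HasDerivAt (fun z => Real.exp (α * z)) (Real.exp (α * z) * α) z := by
      simpa using ((hasDerivAt_id z).const_mul α).exp
    rw [(h2.fun_mul h1).deriv, pow_succ, ← hH, mul_add, add_mul, map_add, 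
      mul_comm H (PowerSeries.C α),
      mul_assoc (PowerSeries.C α), PowerSeries.coeff_C_mul]
    ring

theorem IsBinomialType.iteratedDeriv_exp_mul_eval_zero {p : ℕ → ℝ[X]} (hp : IsBinomialType p)
    (α x : ℝ) (m R : ℕ) :
    iteratedDeriv R (fun z : ℝ => Real.exp (α * z) * (p m).eval (R * x + z)) 0 =
      m.factorial * PowerSeries.coeff m (((PowerSeries.C α + logEgf p) * egf p x) ^ R) := by
  rw [hp.iteratedDeriv_exp_mul_eval]
  simp [mul_pow, hp.egf_natCast_mul]

theorem deriv_eval_zero (p : ℝ[X]) : deriv (fun z : ℝ => p.eval z) 0 = p.coeff 1 := by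
  rw [Polynomial.deriv, ← coeff_zero_eq_eval_zero, coeff_derivative]
  simp

theorem IsBinomialType.coeff_one_logEgf_shifted {f : ℕ → ℝ[X]} (hf : IsBinomialType f) (a : ℝ) :
    PowerSeries.coeff 1 (logEgf (BellBinomial.shifted f a)) = (f 1).coeff 1 := by
  have hc : (f 1).divX.natDegree = 0 := by
    rw [natDegree_divX_eq_natDegree_tsub_one]
    have := hf.natDegree_le 1
    omega
  rw [logEgf, PowerSeries.coeff_mk, BellBinomial.shifted, if_neg one_ne_zero, coeff_X_mul,
    eq_C_of_natDegree_eq_zero hc]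
  simp

end BellBinomial

open BellBinomial in
theorem theorem2 (f : ℕ → Polynomial ℝ) (hf : BellBinomial.IsBinomialType f)
    (a x α : ℝ) (n r s : ℕ) (hn : 1 ≤ n) (hr : 1 ≤ r) :
    (α ≠ 0 →
      BellBinomial.completeBell (fun m => (s : ℝ) * BellBinomial.zExp f a x α r m 0) n =
        (s : ℝ) * BellBinomial.zExp f a x α r n s) ∧
    (deriv (fun z : ℝ => (f 1).eval z) 0 ≠ 0 →
      BellBinomial.completeBell (fun m => (s : ℝ) * BellBinomial.zPoly f a x r m 0) n =
        (s : ℝ) * BellBinomial.zPoly f a x r n s) := by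
  have hp := hf.shifted a
  constructor
  · intro hα
    refine completeBell_of_coeff_pow
      (Φ := (PowerSeries.C α + logEgf (shifted f a)) * egf (shifted f a) x) (β := α) ?_ hα s
      (Nat.one_le_iff_ne_zero.mp hr) (Nat.one_le_iff_ne_zero.mp hn)
      (fun m q => zExp f a x α r m q) fun m q => ?_
    · rw [map_mul, map_add, hp.constantCoeff_logEgf, PowerSeries.constantCoeff_C, add_zero,
        ← PowerSeries.coeff_zero_eq_constantCoeff_apply, hp.coeff_zero_egf, mul_one]
    · rw [zExp, hp.iteratedDeriv_exp_mul_eval_zero]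
  · intro hβ
    -- With `α = 0`, write `g = t L`: then `g^R = t^R L^R`, so the index `R + m` drops to `m`, and
    -- `L(0) = f₁'(0)` plays the role of `β`.
    obtain ⟨L, hL⟩ := hp.X_dvd_logEgf
    refine completeBell_of_coeff_pow (Φ := L * egf (shifted f a) x) ?_ hβ s
      (Nat.one_le_iff_ne_zero.mp hr) (Nat.one_le_iff_ne_zero.mp hn)
      (fun m q => zPoly f a x r m q) fun m q => ?_
    · have h1 := hf.coeff_one_logEgf_shifted a
      rw [hL, PowerSeries.coeff_succ_X_mul] at h1
      rw [deriv_eval_zero, map_mul, ← PowerSeries.coeff_zero_eq_constantCoeff_apply, h1,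
        ← PowerSeries.coeff_zero_eq_constantCoeff_apply, hp.coeff_zero_egf, mul_one]
    · have h := hp.iteratedDeriv_exp_mul_eval_zero 0 x (m * r + q + m) (m * r + q)
      simp only [zero_mul, Real.exp_zero, one_mul, map_zero, zero_add] at h
      rw [hL, mul_assoc, mul_pow, add_comm (m * r + q) m, PowerSeries.coeff_X_pow_mul] at h
      rw [zPoly, add_comm (m * r + q) m, h]
      have : ((m + (m * r + q)).factorial : ℝ) ≠ 0 := by positivity
      field_simp
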